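/- All graphs are simple and undirected. For a graph $G$ let $\omega(G)$ be its clique number and $\chi(G)$ its chromatic number. For a positive integer $i$, an $i$-packing in $G$ is a set $W$ of vertices such that any two distinct vertices of $W$ are at distance greater than $i$ in $G$ (vertices in different components are at infinite distance). The packing chromatic number $\chi_\rho(G)$ is the smallest integer $r$ such that the vertex set of $G$ can be partitioned into (possibly empty) sets $V_1,\dots,V_r$ where $V_i$ is an $i$-packing for every $i\in\{1,\dots,r\}$ ($\chi_\rho(G)=\infty$ if there is no such $r$). **Theorem.** For every integer $k\ge 4$ there is no graph $G$ with $\omega(G)=2$, $\chi(G)=k$ and $\chi_\rho(G)=k+2$. Equivalently, no triangle-free graph $G$ satisfies $\chi(G)=k$ and $\chi_\rho(G)=k+2$. -/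

import Mathlib

namespace SimpleGraph

/-- `W` is an `i`-packing of `G`: any two distinct vertices of `W` are at distance greater than `i`
(vertices in different components are at distance `⊤`). -/
def IsPacking {V : Type*} (G : SimpleGraph V) (i : ℕ) (W : Set V) : Prop :=
  ∀ u ∈ W, ∀ v ∈ W, u ≠ v → (i : ℕ∞) < G.edist u v

/-- `c` is a `k`-packing coloring of `G`: it takes values in `{1, …, k}` and for each color
`i ∈ {1, …, k}` the class of the vertices of color `i` is an `i`-packing. -/
def IsPackingColoring {V : Type*} (G : SimpleGraph V) (k : ℕ) (c : V → ℕ) : Prop :=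
  (∀ v, c v ∈ Set.Icc 1 k) ∧ ∀ i ∈ Set.Icc 1 k, G.IsPacking i (c ⁻¹' {i})

/-- The packing chromatic number of `G`: the least `k` such that `G` has a `k`-packing coloring,
and `⊤` if there is none (which can only happen for an infinite graph). -/
noncomputable def packingChromaticNumber {V : Type*} (G : SimpleGraph V) : ℕ∞ :=
  ⨅ k ∈ {k : ℕ | ∃ c : V → ℕ, G.IsPackingColoring k c}, (k : ℕ∞)

/-- `G` realizes the triple `(a, b, c)`: its clique number is `a`, its chromatic number is `b`
and its packing chromatic number is `c`. -/
def Realizes {V : Type*} (G : SimpleGraph V) (a b c : ℕ) : Prop :=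
  G.cliqueNum = a ∧ G.chromaticNumber = b ∧ G.packingChromaticNumber = c

end SimpleGraph

/-!
A triangle-free graph `G` with a packing coloring in `k + 2` colors, `k ≥ 4`, is properly
`(k - 1)`-colorable (`IsPackingColoring.colorable`), so its chromatic number is not `k`. Each color
above 6 may serve as a color of its own, so the point is to color the vertices with packing colors
`1, …, 6` properly with three colors (`exists_three_coloring`).

Give the first color to the vertices of packing color 1; the others would have to induce a
bipartite graph, which may fail. A vertex `z` of packing color 2 can be moved to the first color,
its neighbors of color 1 being moved out, if each of these has at most one neighbor of color
`3, …, 6`: its only neighbor of color 2 is `z`, so it becomes a vertex of degree at most 1 among the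
vertices outside the first color. As distinct vertices of color 2 have disjoint neighborhoods, all
these moves can be made at the same time. What remains is the *core*: the vertices of color
`3, …, 6` and the *anchored* vertices `z` of color 2, which have a neighbor `y` of color 1 with two
neighbors `p`, `q` of colors in `{3, …, 6}`.

The core has no odd cycle (`core_colorable_two`). Around an anchored vertex `z` on a cycle, the two
neighbors of `z` on the cycle and `p`, `q` have the four colors `3, …, 6`
(`IsCoreLine.colors_at_anchor`), and the vertices at distance two from `z` on the cycle have the
colors of `p`, `q`, and coincide with them if these colors are at least 4
(`IsCoreLine.second_color`). On a 5-cycle this yields a triangle. On a cycle of length at least 7,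
any two vertices at most six steps apart are distinct, and following the cycle a few steps further
leaves no admissible color; here the walk through `y` brings vertices closer together than the
cycle does. Thus color 2 does not occur (`IsCoreLine.color_ne_two`), but then two vertices of equal
color are too close (`not_isCoreLine_six`). Odd cycles are unrolled to periodic functions on `ℤ`,
which makes shifting and reflecting them simple.
-/

namespace SimpleGraph

variable {V : Type*} {G : SimpleGraph V} {c : V → ℕ}

/-! ### Packing colorings and walks -/

/-- `c` separates color classes as a packing coloring does, in the language of walks: two vertices
of color `i` that are joined by a walk of length at most `i` coincide. -/
def WalkSeparated (G : SimpleGraph V) (c : V → ℕ) : Prop :=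
  ∀ ⦃u v : V⦄ (w : G.Walk u v), c u = c v → w.length ≤ c u → u = v

lemma IsPackingColoring.walkSeparated {k : ℕ} (h : G.IsPackingColoring k c) :
    G.WalkSeparated c := by
  intro u v w huv hw
  by_contra hne
  have h1 := h.2 (c u) (h.1 u) u rfl v huv.symm hne
  have h2 : G.edist u v ≤ (c u : ℕ∞) := w.edist_le.trans (by exact_mod_cast hw)
  exact absurd h1 (not_lt.mpr h2)

/-! ### Anchored vertices and the core -/

/-- `y` is a neighbor of `z` of color 1 that has two further neighbors `p ≠ q` with colors
in `{3, …, 6}`. -/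
structure IsAnchor (G : SimpleGraph V) (c : V → ℕ) (z y p q : V) : Prop where
  adj_y : G.Adj z y
  adj_p : G.Adj y p
  adj_q : G.Adj y q
  color_y : c y = 1
  ne : p ≠ q
  three_le_p : 3 ≤ c p
  le_six_p : c p ≤ 6
  three_le_q : 3 ≤ c q
  le_six_q : c q ≤ 6

lemma IsAnchor.swap {z y p q : V} (h : G.IsAnchor c z y p q) : G.IsAnchor c z y q p :=
  ⟨h.adj_y, h.adj_q, h.adj_p, h.color_y, h.ne.symm, h.three_le_q, h.le_six_q, h.three_le_p,
    h.le_six_p⟩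

/-- `z` has an anchor. A vertex of color 2 without an anchor can change places with its neighbors
of color 1, since each of these has at most one further neighbor outside color 1. -/
def IsAnchored (G : SimpleGraph V) (c : V → ℕ) (z : V) : Prop :=
  ∃ y p q, G.IsAnchor c z y p q

/-- The vertices of the core: colors `2, …, 6`, where those of color 2 have to be anchored. -/
def InCore (G : SimpleGraph V) (c : V → ℕ) (v : V) : Prop :=
  2 ≤ c v ∧ c v ≤ 6 ∧ (c v = 2 → G.IsAnchored c v)

/-- The edges of `G` inside the core, as a graph on all of `V`. -/
def core (G : SimpleGraph V) (c : V → ℕ) : SimpleGraph V where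
  Adj u v := G.Adj u v ∧ G.InCore c u ∧ G.InCore c v
  symm := ⟨fun _ _ h => ⟨h.1.symm, h.2.2, h.2.1⟩⟩
  loopless := ⟨fun _ h => h.1.ne rfl⟩

/-! ### Lines in the core -/

/-- A two-way infinite walk in the core any `m + 1` consecutive vertices of which are distinct. -/
structure IsCoreLine (G : SimpleGraph V) (c : V → ℕ) (m : ℕ) (f : ℤ → V) : Prop where
  adj : ∀ i j : ℤ, j = i + 1 → G.Adj (f i) (f j)
  inCore : ∀ i, G.InCore c (f i)
  ne : ∀ i j : ℤ, i < j → j ≤ i + m → f i ≠ f j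

namespace IsCoreLine

variable {m : ℕ} {f : ℤ → V}

lemma shift (h : G.IsCoreLine c m f) (t : ℤ) : G.IsCoreLine c m (fun i => f (i + t)) :=
  ⟨fun i j hij => h.adj _ _ (by omega), fun i => h.inCore _,
    fun i j hij hj => h.ne _ _ (by omega) (by omega)⟩

lemma reflect (h : G.IsCoreLine c m f) : G.IsCoreLine c m (fun i => f (-i)) :=
  ⟨fun i j hij => (h.adj _ _ (by omega)).symm, fun i => h.inCore _,
    fun i j hij hj => (h.ne _ _ (by omega) (by omega)).symm⟩

lemma exists_walk (h : G.IsCoreLine c m f) (i : ℤ) (d : ℕ) :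
    ∃ w : G.Walk (f i) (f (i + d)), w.length = d := by
  induction d with
  | zero => exact ⟨Walk.nil.copy rfl (by simp), by simp⟩
  | succ d ih =>
    obtain ⟨w, hw⟩ := ih
    exact ⟨w.concat (h.adj _ _ (by push_cast; ring)), by simp [hw]⟩

lemma color_lt (h : G.IsCoreLine c m f) (hc : G.WalkSeparated c) (i j : ℤ) (hij : i < j)
    (hj : j ≤ i + m) (hcol : c (f i) = c (f j)) : (c (f i) : ℤ) < j - i := by
  by_contra hlt
  obtain ⟨d, rfl⟩ : ∃ d : ℕ, j = i + d := ⟨(j - i).toNat, by omega⟩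
  obtain ⟨w, hw⟩ := h.exists_walk i d
  exact h.ne _ _ hij hj (hc w hcol (by omega))

end IsCoreLine

variable {m : ℕ} {f : ℤ → V} {y p q : V}

lemma not_adj_of_cliqueFree (hG : G.CliqueFree 3) {u v w : V} (h1 : G.Adj u v) (h2 : G.Adj v w) :
    ¬ G.Adj u w := by
  classical
  intro h3
  exact hG {u, v, w} (is3Clique_triple_iff.mpr ⟨h1, h3, h2⟩)

lemma IsAnchor.color_ne (hc : G.WalkSeparated c) {z : V} (ha : G.IsAnchor c z y p q) :
    c p ≠ c q := by
  intro h
  have := ha.three_le_p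
  exact ha.ne (hc (.cons ha.adj_p.symm (.cons ha.adj_q .nil)) h (by simp; omega))

/-- The endpoint `p` of an anchor of `z` shares its color with no neighbor of `z`: the two are
joined by a walk of length 3, and if they coincided there would be a triangle. -/
lemma IsAnchor.color_ne_of_adj (hG : G.CliqueFree 3) (hc : G.WalkSeparated c) {z u : V}
    (ha : G.IsAnchor c z y p q) (hzu : G.Adj z u) : c u ≠ c p := by
  intro h
  have := ha.three_le_p
  have e : u = p := hc (.cons hzu.symm (.cons ha.adj_y (.cons ha.adj_p .nil))) h (by simp; omega)
  subst e
  exact not_adj_of_cliqueFree hG ha.adj_y ha.adj_p hzu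

namespace IsCoreLine

/-- Around an anchored vertex of color 2 on a core line, the two neighbors on the line and the two
endpoints of the anchor carry the colors `3, 4, 5, 6` in some order. -/
lemma colors_at_anchor (h : G.IsCoreLine c m f) (hG : G.CliqueFree 3) (hc : G.WalkSeparated c)
    (hm : 2 ≤ m) (h0 : c (f 0) = 2) (ha : G.IsAnchor c (f 0) y p q) :
    3 ≤ c (f (-1)) ∧ c (f (-1)) ≤ 6 ∧ 3 ≤ c (f 1) ∧ c (f 1) ≤ 6 ∧ c (f (-1)) ≠ c (f 1) ∧
      c (f (-1)) ≠ c p ∧ c (f (-1)) ≠ c q ∧ c (f 1) ≠ c p ∧ c (f 1) ≠ c q ∧ c p ≠ c q := by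
  have a := h.adj 0 1 (by norm_num)
  have b := h.adj (-1) 0 (by norm_num)
  have h1 := h.color_lt hc (-1) 0 (by omega) (by omega)
  have h2 := h.color_lt hc 0 1 (by omega) (by omega)
  have h3 := h.color_lt hc (-1) 1 (by omega) (by omega)
  have c1 := h.inCore (-1)
  have c2 := h.inCore 1
  have r1 := c1.1
  have r2 := c1.2.1
  have r3 := c2.1
  have r4 := c2.2.1
  have := ha.color_ne_of_adj hG hc a
  have := ha.color_ne_of_adj hG hc b.symm
  have := ha.swap.color_ne_of_adj hG hc a
  have := ha.swap.color_ne_of_adj hG hc b.symm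
  have := ha.color_ne hc
  omega

/-- The second vertex after an anchored vertex of color 2 has the color of an endpoint of the
anchor, and is that endpoint unless its color is 3. -/
lemma second_color (h : G.IsCoreLine c m f) (hG : G.CliqueFree 3) (hc : G.WalkSeparated c)
    (hm : 3 ≤ m) (h0 : c (f 0) = 2) (ha : G.IsAnchor c (f 0) y p q) :
    (c (f 2) = c p ∧ (c p = 3 ∨ f 2 = p)) ∨ (c (f 2) = c q ∧ (c q = 3 ∨ f 2 = q)) := by
  have key : ∀ {p q : V}, G.IsAnchor c (f 0) y p q → c (f 2) = c p → c p = 3 ∨ f 2 = p := by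
    intro p q ha hp
    by_cases h3 : c p = 3
    · exact .inl h3
    · have := ha.three_le_p
      exact .inr (hc (.cons (h.adj 1 2 (by norm_num)).symm (.cons (h.adj 0 1 (by norm_num)).symm
        (.cons ha.adj_y (.cons ha.adj_p .nil)))) hp (by simp; omega))
  have kp := key ha
  have kq := key ha.swap
  have h1 := h.color_lt hc 0 2 (by omega) (by omega)
  have h2 := h.color_lt hc 1 2 (by omega) (by omega)
  have h3 := h.color_lt hc (-1) 2 (by omega) (by omega)
  have r1 := (h.inCore 2).1
  have r2 := (h.inCore 2).2.1
  have A := h.colors_at_anchor hG hc (by omega) h0 ha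
  have r3 := ha.three_le_p
  have r4 := ha.le_six_p
  have r5 := ha.three_le_q
  have r6 := ha.le_six_q
  have hpq : c (f 2) = c p ∨ c (f 2) = c q := by omega
  exact hpq.imp (fun e => ⟨e, kp e⟩) (fun e => ⟨e, kq e⟩)

lemma second_color' (h : G.IsCoreLine c m f) (hG : G.CliqueFree 3) (hc : G.WalkSeparated c)
    (hm : 3 ≤ m) (h0 : c (f 0) = 2) (ha : G.IsAnchor c (f 0) y p q) :
    (c (f (-2)) = c p ∧ (c p = 3 ∨ f (-2) = p)) ∨
      (c (f (-2)) = c q ∧ (c q = 3 ∨ f (-2) = q)) :=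
  h.reflect.second_color hG hc hm (by simpa using h0) (by simpa using ha)

/-- If neither endpoint of the anchor had color 3, the line would read, up to reflection,
`4, 2, p, 3, 2, 4, q` (giving colors except for the vertices `p` and `q`), and the anchor of the
other vertex of color 2, which also ends at `q`, would join the two vertices of color 4 by a walk
of length 4. -/
lemma not_anchor_of_four_le_aux (h : G.IsCoreLine c 6 f) (hG : G.CliqueFree 3)
    (hc : G.WalkSeparated c) (h0 : c (f 0) = 2) (ha : G.IsAnchor c (f 0) y p q)
    (hp : 4 ≤ c p) (hq : 4 ≤ c q) (hl : c (f (-1)) = 3) (e2 : f (-2) = p) (e2' : f 2 = q) :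
    False := by
  have A := h.colors_at_anchor hG hc (by omega) h0 ha
  have r4 := ha.le_six_p
  have r6 := ha.le_six_q
  have a12 := h.adj 1 2 (by norm_num)
  have a32 := h.adj (-3) (-2) (by norm_num)
  have a43 := h.adj (-4) (-3) (by norm_num)
  rw [e2'] at a12
  rw [e2] at a32
  have z3 : c (f (-3)) = 2 := by
    have r1 := (h.inCore (-3)).1
    have r2 := (h.inCore (-3)).2.1
    have h1 := h.color_lt hc (-3) (-1) (by omega) (by omega)
    have h2 := h.color_lt hc (-3) (-2) (by omega) (by omega)
    have h3 := h.color_lt hc (-3) 1 (by omega) (by omega)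
    have h4 : c (f (-3)) ≠ c q := fun e => h.ne (-3) 2 (by omega) (by omega) <| e2' ▸
      hc (.cons a32 (.cons ha.adj_p.symm (.cons ha.adj_q .nil))) e (by simp; omega)
    rw [e2] at h2
    omega
  obtain ⟨y', p', q', hb⟩ := (h.inCore (-3)).2.2 z3
  have B := (h.shift (-3)).colors_at_anchor hG hc (by omega) (by simpa using z3)
    (by simpa using hb)
  norm_num at B
  rw [e2] at B
  have r1 := hb.three_le_p
  have r2 := hb.le_six_p
  have r3 := hb.three_le_q
  have r5 := hb.le_six_q
  have h4 : c (f (-4)) ≠ c q := fun e => h.ne (-4) 2 (by omega) (by omega) <| e2' ▸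
    hc (.cons a43 (.cons a32 (.cons ha.adj_p.symm (.cons ha.adj_q .nil)))) e (by simp; omega)
  have h5 := h.color_lt hc (-4) (-1) (by omega) (by omega)
  have h6 := h.color_lt hc (-4) 1 (by omega) (by omega)
  have key : ∀ {p' q' : V}, G.IsAnchor c (f (-3)) y' p' q' → c p' = c q → False := by
    intro p' q' hb e
    have e' : p' = q := hc (.cons hb.adj_p.symm (.cons hb.adj_y.symm (.cons a32
      (.cons ha.adj_p.symm (.cons ha.adj_q .nil))))) e (by simp; omega)
    subst e'
    exact h.ne (-4) 1 (by omega) (by omega) (hc (.cons a43 (.cons hb.adj_y (.cons hb.adj_p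
      (.cons a12.symm .nil)))) (by omega) (by simp; omega))
  have : c p' = c q ∨ c q' = c q := by omega
  rcases this with e | e
  · exact key hb e
  · exact key hb.swap e

lemma color_eq_three_of_anchor (h : G.IsCoreLine c 6 f) (hG : G.CliqueFree 3)
    (hc : G.WalkSeparated c) (h0 : c (f 0) = 2) (ha : G.IsAnchor c (f 0) y p q) :
    c p = 3 ∨ c q = 3 := by
  by_contra hcon
  push Not at hcon
  have r3 := ha.three_le_p
  have r5 := ha.three_le_q
  have r4 := ha.le_six_p
  have r6 := ha.le_six_q
  have A := h.colors_at_anchor hG hc (by omega) h0 ha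
  have hp : 4 ≤ c p := by omega
  have hq : 4 ≤ c q := by omega
  have hne := h.ne (-2) 2 (by omega) (by omega)
  have hpq : (f (-2) = p ∧ f 2 = q) ∨ (f (-2) = q ∧ f 2 = p) := by
    rcases h.second_color hG hc (by omega) h0 ha with ⟨-, e | e⟩ | ⟨-, e | e⟩ <;>
    rcases h.second_color' hG hc (by omega) h0 ha with ⟨-, e' | e'⟩ | ⟨-, e' | e'⟩ <;>
    first | omega | exact absurd (e'.trans e.symm) hne | simp [e, e']
  have hr := h.reflect
  have h0' : c (f (-0)) = 2 := by simpa using h0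
  have ha' : G.IsAnchor c (f (-0)) y p q := by simpa using ha
  have : c (f (-1)) = 3 ∨ c (f 1) = 3 := by omega
  rcases this with hl | hl <;> rcases hpq with ⟨e, e'⟩ | ⟨e, e'⟩
  · exact h.not_anchor_of_four_le_aux hG hc h0 ha hp hq hl e e'
  · exact h.not_anchor_of_four_le_aux hG hc h0 ha.swap hq hp hl e e'
  · exact hr.not_anchor_of_four_le_aux hG hc h0' ha'.swap hq hp (by simpa using hl)
      (by simpa using e') (by simpa using e)
  · exact hr.not_anchor_of_four_le_aux hG hc h0' ha' hp hq (by simpa using hl)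
      (by simpa using e') (by simpa using e)

/-- Colors 2 and 3 are never consecutive on a core line: the anchor of the vertex of color 2
already has an endpoint of color 3. -/
lemma color_succ_ne_three (h : G.IsCoreLine c 6 f) (hG : G.CliqueFree 3)
    (hc : G.WalkSeparated c) (i : ℤ) (hi : c (f i) = 2) : c (f (i + 1)) ≠ 3 := by
  obtain ⟨y, p, q, ha⟩ := (h.inCore i).2.2 hi
  have hs := h.shift i
  have A := hs.colors_at_anchor hG hc (by omega) (by simpa using hi) (by simpa using ha)
  have B := hs.color_eq_three_of_anchor hG hc (by simpa using hi) (by simpa using ha)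
  rw [add_comm i 1]
  omega

lemma color_pred_ne_three (h : G.IsCoreLine c 6 f) (hG : G.CliqueFree 3)
    (hc : G.WalkSeparated c) (i : ℤ) (hi : c (f i) = 2) : c (f (i - 1)) ≠ 3 := by
  have := h.reflect.color_succ_ne_three hG hc (-i) (by simpa using hi)
  rwa [show -(-i + 1) = i - 1 by ring] at this

/-- The case where both vertices at distance two on the line have color 3: the line reads
`4, 3, 5, 2, 6, 3, 4` and cannot be prolonged by two vertices at the left end. -/
lemma false_of_three_three (h : G.IsCoreLine c 6 f) (hG : G.CliqueFree 3)
    (hc : G.WalkSeparated c) (h0 : c (f 0) = 2) (ha : G.IsAnchor c (f 0) y p q) (hp : c p = 3)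
    (h2 : c (f 2) = 3) (h2' : c (f (-2)) = 3) (hlt : c (f (-1)) < c (f 1)) : False := by
  have A := h.colors_at_anchor hG hc (by omega) h0 ha
  have r5 := ha.three_le_q
  have r6 := ha.le_six_q
  have s3 : c (f 3) = c q := by
    have r1 := (h.inCore 3).1
    have r2 := (h.inCore 3).2.1
    have t1 := h.color_lt hc 2 3 (by omega) (by omega)
    have t2 := h.color_lt hc 1 3 (by omega) (by omega)
    have t3 := h.color_lt hc (-1) 3 (by omega) (by omega)
    have t4 := h.color_pred_ne_three hG hc 3
    norm_num at t4
    omega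
  have s3' : c (f (-3)) = c q := by
    have r1 := (h.inCore (-3)).1
    have r2 := (h.inCore (-3)).2.1
    have t1 := h.color_lt hc (-3) (-2) (by omega) (by omega)
    have t2 := h.color_lt hc (-3) (-1) (by omega) (by omega)
    have t3 := h.color_lt hc (-3) 1 (by omega) (by omega)
    have t4 := h.color_succ_ne_three hG hc (-3)
    norm_num at t4
    omega
  have q4 : c q = 4 := by
    by_contra hq
    have a01 := h.adj 0 1 (by norm_num)
    have a12 := h.adj 1 2 (by norm_num)
    have a23 := h.adj 2 3 (by norm_num)
    have b01 := h.adj (-1) 0 (by norm_num)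
    have b12 := h.adj (-2) (-1) (by norm_num)
    have b23 := h.adj (-3) (-2) (by norm_num)
    have e : f 3 = q := hc (.cons a23.symm (.cons a12.symm (.cons a01.symm (.cons ha.adj_y
      (.cons ha.adj_q .nil))))) s3 (by simp; omega)
    have e' : f (-3) = q := hc (.cons b23 (.cons b12 (.cons b01 (.cons ha.adj_y
      (.cons ha.adj_q .nil))))) s3' (by simp; omega)
    exact h.ne (-3) 3 (by omega) (by omega) (e'.trans e.symm)
  have s4 : c (f (-4)) = 2 := by
    have r1 := (h.inCore (-4)).1
    have r2 := (h.inCore (-4)).2.1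
    have t1 := h.color_lt hc (-4) (-3) (by omega) (by omega)
    have t2 := h.color_lt hc (-4) (-2) (by omega) (by omega)
    have t3 := h.color_lt hc (-4) (-1) (by omega) (by omega)
    have t4 := h.color_lt hc (-4) 1 (by omega) (by omega)
    omega
  have r1 := (h.inCore (-5)).1
  have r2 := (h.inCore (-5)).2.1
  have t1 := h.color_lt hc (-5) (-4) (by omega) (by omega)
  have t2 := h.color_lt hc (-5) (-3) (by omega) (by omega)
  have t3 := h.color_lt hc (-5) (-2) (by omega) (by omega)
  have t4 := h.color_lt hc (-5) (-1) (by omega) (by omega)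
  have t5 := h.color_lt hc (-5) 1 (by omega) (by omega)
  omega

/-- The case where the line passes through the endpoint `q` of the anchor on one side and through
color 3 on the other: the line reads `3, 4, 2, ·, q, 2, 4` and cannot be prolonged to the left. -/
lemma false_of_three_endpoint (h : G.IsCoreLine c 6 f) (hG : G.CliqueFree 3)
    (hc : G.WalkSeparated c) (h0 : c (f 0) = 2) (ha : G.IsAnchor c (f 0) y p q) (hp : c p = 3)
    (h2 : f 2 = q) (h2' : c (f (-2)) = 3) : False := by
  have A := h.colors_at_anchor hG hc (by omega) h0 ha
  have r5 := ha.three_le_q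
  have r6 := ha.le_six_q
  have a23 := h.adj 2 3 (by norm_num)
  have c2 : c (f 2) = c q := by rw [h2]
  rw [h2] at a23
  have s3 : c (f 3) = 2 := by
    have r1 := (h.inCore 3).1
    have r2 := (h.inCore 3).2.1
    have t1 := h.color_lt hc 2 3 (by omega) (by omega)
    have t2 := h.color_lt hc 1 3 (by omega) (by omega)
    have t3 := h.color_lt hc (-1) 3 (by omega) (by omega)
    have t4 : c (f 3) ≠ c p := fun e => by
      have e' : f 3 = p := hc (.cons a23.symm (.cons ha.adj_q.symm (.cons ha.adj_p .nil))) e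
        (by simp; omega)
      rw [e'] at a23
      exact not_adj_of_cliqueFree hG ha.adj_q a23 ha.adj_p
    omega
  have l4 : c (f (-1)) = 4 := by
    have r1 := (h.inCore 4).1
    have r2 := (h.inCore 4).2.1
    have t1 := h.color_lt hc 3 4 (by omega) (by omega)
    have t2 := h.color_lt hc 2 4 (by omega) (by omega)
    have t3 := h.color_lt hc 1 4 (by omega) (by omega)
    have t4 := h.color_lt hc (-1) 4 (by omega) (by omega)
    have t5 := h.color_succ_ne_three hG hc 3 s3
    norm_num at t5
    omega
  have r1 := (h.inCore (-3)).1
  have r2 := (h.inCore (-3)).2.1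
  have t1 := h.color_lt hc (-3) (-2) (by omega) (by omega)
  have t2 := h.color_lt hc (-3) (-1) (by omega) (by omega)
  have t3 := h.color_lt hc (-3) 1 (by omega) (by omega)
  have t4 := h.color_succ_ne_three hG hc (-3)
  norm_num at t4
  have t5 : c (f (-3)) ≠ c q := fun e => h.ne (-3) 2 (by omega) (by omega) <| h2 ▸
    hc (.cons (h.adj (-3) (-2) (by norm_num)) (.cons (h.adj (-2) (-1) (by norm_num))
      (.cons (h.adj (-1) 0 (by norm_num)) (.cons ha.adj_y (.cons ha.adj_q .nil))))) e
      (by simp; omega)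
  omega

lemma color_ne_two (h : G.IsCoreLine c 6 f) (hG : G.CliqueFree 3) (hc : G.WalkSeparated c)
    (i : ℤ) : c (f i) ≠ 2 := by
  intro hi
  obtain ⟨y, p, q, ha⟩ := (h.inCore i).2.2 hi
  obtain ⟨f, h, h0, ha⟩ : ∃ f : ℤ → V, G.IsCoreLine c 6 f ∧ c (f 0) = 2 ∧
      G.IsAnchor c (f 0) y p q :=
    ⟨_, h.shift i, by simpa using hi, by simpa using ha⟩
  obtain ⟨p, q, ha, hp⟩ : ∃ p q, G.IsAnchor c (f 0) y p q ∧ c p = 3 := by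
    rcases h.color_eq_three_of_anchor hG hc h0 ha with e | e
    · exact ⟨p, q, ha, e⟩
    · exact ⟨q, p, ha.swap, e⟩
  have A := h.colors_at_anchor hG hc (by omega) h0 ha
  have hr := h.reflect
  have h0' : c (f (-0)) = 2 := by simpa using h0
  have ha' : G.IsAnchor c (f (-0)) y p q := by simpa using ha
  have F : c (f 2) = 3 ∨ f 2 = q := by
    rcases h.second_color hG hc (by omega) h0 ha with ⟨e, -⟩ | ⟨e, e' | e'⟩
    · exact .inl (e.trans hp)
    · omega
    · exact .inr e'
  have B : c (f (-2)) = 3 ∨ f (-2) = q := by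
    rcases h.second_color' hG hc (by omega) h0 ha with ⟨e, -⟩ | ⟨e, e' | e'⟩
    · exact .inl (e.trans hp)
    · omega
    · exact .inr e'
  rcases F with F | F <;> rcases B with B | B
  · rcases lt_or_gt_of_ne A.2.2.2.2.1 with hlt | hlt
    · exact h.false_of_three_three hG hc h0 ha hp F B hlt
    · exact hr.false_of_three_three hG hc h0' ha' hp B (by simpa using F) (by simpa using hlt)
  · exact hr.false_of_three_endpoint hG hc h0' ha' hp B (by simpa using F)
  · exact h.false_of_three_endpoint hG hc h0 ha hp F B
  · exact h.ne (-2) 2 (by omega) (by omega) (B.trans F.symm)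

end IsCoreLine

/-- There is no core line with seven consecutive distinct vertices throughout: color 2 does not
occur, and six consecutive vertices cannot have colors in `{3, …, 6}`. -/
lemma not_isCoreLine_six (hG : G.CliqueFree 3) (hc : G.WalkSeparated c) :
    ¬ G.IsCoreLine c 6 f := by
  intro h
  have key : ∀ i, c (f i) = 3 := by
    intro i
    have three_le : ∀ j, 3 ≤ c (f j) := fun j =>
      Nat.lt_of_le_of_ne (h.inCore j).1 (h.color_ne_two hG hc j).symm
    have hne : ∀ j k : ℤ, j < k → k ≤ j + 3 → c (f j) ≠ c (f k) := fun j k hjk hk e => by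
      have := h.color_lt hc j k hjk (by omega) e
      have := three_le j
      omega
    have d01 := hne i (i + 1) (by omega) (by omega)
    have d02 := hne i (i + 2) (by omega) (by omega)
    have d03 := hne i (i + 3) (by omega) (by omega)
    have d12 := hne (i + 1) (i + 2) (by omega) (by omega)
    have d13 := hne (i + 1) (i + 3) (by omega) (by omega)
    have d14 := hne (i + 1) (i + 4) (by omega) (by omega)
    have d23 := hne (i + 2) (i + 3) (by omega) (by omega)
    have d24 := hne (i + 2) (i + 4) (by omega) (by omega)
    have d34 := hne (i + 3) (i + 4) (by omega) (by omega)
    have b0 := three_le i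
    have b1 := three_le (i + 1)
    have b2 := three_le (i + 2)
    have b3 := three_le (i + 3)
    have b4 := three_le (i + 4)
    have u0 := (h.inCore i).2.1
    have u1 := (h.inCore (i + 1)).2.1
    have u2 := (h.inCore (i + 2)).2.1
    have u3 := (h.inCore (i + 3)).2.1
    have u4 := (h.inCore (i + 4)).2.1
    have e : c (f i) = c (f (i + 4)) := by omega
    have := h.color_lt hc i (i + 4) (by omega) (by omega) e
    omega
  have := h.color_lt hc 0 1 (by omega) (by omega) ((key 0).trans (key 1).symm)
  have := key 0
  omega

/-- The core has no 5-cycle: all five colors would occur on it, and the endpoints of an anchor of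
its vertex of color 2 would be the two opposite vertices of the cycle, which are adjacent. -/
lemma not_isCoreLine_four_of_periodic (hG : G.CliqueFree 3) (hc : G.WalkSeparated c)
    (hper : ∀ i, f (i + 5) = f i) : ¬ G.IsCoreLine c 4 f := by
  intro h
  obtain ⟨i, hi⟩ : ∃ i, c (f i) = 2 := by
    by_contra hcon
    push Not at hcon
    obtain ⟨i, -, j, -, hij, e⟩ := Finset.exists_ne_map_eq_of_card_lt_of_maps_to
      (s := (Finset.univ : Finset (Fin 5))) (t := Finset.Icc 3 6) (by simp)
      (f := fun i => c (f (i : ℕ))) (fun i _ => by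
        have h1 := (h.inCore (i : ℕ)).1
        have h2 := (h.inCore (i : ℕ)).2.1
        have h3 := hcon (i : ℕ)
        simp only [Finset.coe_Icc, Set.mem_Icc]
        omega)
    wlog hlt : (i : ℕ) < j generalizing i j
    · exact this j i hij.symm e.symm (by omega)
    have h2 := (h.inCore (i : ℕ)).1
    -- One of the two arcs of the 5-cycle between the two vertices has length at most 2.
    by_cases hd : (j : ℕ) ≤ i + 2
    · have := h.color_lt hc (i : ℕ) (j : ℕ) (by omega) (by omega) e
      omega
    · have := h.color_lt hc (j : ℕ) ((i : ℕ) + 5) (by omega) (by omega)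
        (by rw [hper]; exact e.symm)
      rw [← e] at this
      omega
  obtain ⟨y, p, q, ha⟩ := (h.inCore i).2.2 hi
  obtain ⟨f, h, h0, ha, e3⟩ : ∃ f : ℤ → V, G.IsCoreLine c 4 f ∧ c (f 0) = 2 ∧
      G.IsAnchor c (f 0) y p q ∧ f 3 = f (-2) :=
    ⟨_, h.shift i, by simpa using hi, by simpa using ha,
      by rw [← hper (-2 + i)]; congr 1; ring⟩
  have a23 := h.adj 2 3 (by norm_num)
  rw [e3] at a23
  have d := h.color_lt hc 2 3 (by omega) (by omega)
  rw [e3] at d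
  have key : ∀ {p q u v : V}, G.IsAnchor c (f 0) y p q → G.Adj u v → u = p → c v = c q →
      False := by
    intro p q u v ha huv e hv
    have := ha.three_le_q
    have e' : v = q := hc (.cons huv.symm (.cons (e ▸ ha.adj_p.symm) (.cons ha.adj_q .nil))) hv
      (by simp; omega)
    exact not_adj_of_cliqueFree hG ha.adj_p (e ▸ e' ▸ huv) ha.adj_q
  have hne := ha.color_ne hc
  have core2 := (h.inCore 2).1
  rcases h.second_color hG hc (by omega) h0 ha with ⟨e, e'⟩ | ⟨e, e'⟩ <;>
    rcases h.second_color' hG hc (by omega) h0 ha with ⟨g, g'⟩ | ⟨g, g'⟩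
  · omega
  · rcases e' with e' | e'
    · rcases g' with g' | g'
      · omega
      · exact key ha.swap a23.symm g' e
    · exact key ha a23 e' g
  · rcases e' with e' | e'
    · rcases g' with g' | g'
      · omega
      · exact key ha a23.symm g' e
    · exact key ha.swap a23 e' g
  · omega

/-! ### The core is bipartite -/

/-- A graph that is not 2-colorable contains an odd cycle, here unrolled to a periodic function:
a shortest odd closed walk repeats no vertex before it closes. -/
lemma exists_periodic_of_not_colorable_two {H : SimpleGraph V} (hH : ¬ H.Colorable 2) :
    ∃ (n : ℕ) (f : ℤ → V), Odd n ∧ (∀ i, H.Adj (f i) (f (i + 1))) ∧ (∀ i, f (i + n) = f i) ∧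
      ∀ i (d : ℕ), 0 < d → d < n → f i ≠ f (i + d) := by
  classical
  have hex : ∃ n, Odd n ∧ ∃ (u : V) (w : H.Walk u u), w.length = n := by
    rw [two_colorable_iff_forall_loop_even] at hH
    push Not at hH
    obtain ⟨u, w, hw⟩ := hH
    exact ⟨w.length, by simpa using hw, u, w, rfl⟩
  obtain ⟨n, ⟨hodd, u, w, hw⟩, hmin⟩ : ∃ n, (Odd n ∧ ∃ (u : V) (w : H.Walk u u), w.length = n) ∧
      ∀ k < n, ¬ (Odd k ∧ ∃ (u : V) (w : H.Walk u u), w.length = k) :=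
    ⟨Nat.find hex, Nat.find_spec hex, fun _ => Nat.find_min hex⟩
  have hn : 0 < n := hodd.pos
  obtain ⟨f, hf⟩ : ∃ f : ℤ → V, ∀ i, f i = w.getVert (i % n).toNat := ⟨_, fun _ => rfl⟩
  have hper : ∀ i : ℤ, f (i + n) = f i := by
    intro i
    simp [hf]
  have hadj : ∀ i : ℤ, H.Adj (f i) (f (i + 1)) := by
    intro i
    rw [hf, hf, ← Int.emod_add_emod i n 1]
    have h1 := Int.emod_nonneg i (b := (n : ℤ)) (by omega)
    have h2 := Int.emod_lt_of_pos i (b := (n : ℤ)) (by omega)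
    generalize i % (n : ℤ) = r at *
    lift r to ℕ using h1
    have h3 := w.adj_getVert_succ (i := r) (by omega)
    by_cases hlast : r + 1 = n
    · rw [show ((r : ℤ) + 1) = n by omega, Int.emod_self, Int.toNat_zero, Walk.getVert_zero]
      rwa [show r + 1 = w.length by omega, Walk.getVert_length] at h3
    · rw [Int.emod_eq_of_lt (by omega) (by omega)]
      exact h3
  have hwalk : ∀ i (d : ℕ), ∃ w : H.Walk (f i) (f (i + d)), w.length = d := by
    intro i d
    induction d with
    | zero => exact ⟨Walk.nil.copy rfl (by simp), by simp⟩
    | succ d ih =>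
      obtain ⟨w, hw⟩ := ih
      refine ⟨(w.concat (hadj _)).copy rfl (by push_cast; ring_nf), by simp [hw]⟩
  refine ⟨n, f, hodd, hadj, hper, fun i d hd hdn heq => ?_⟩
  -- The repetition splits the closed walk into two closed walks, one of which has odd length.
  rcases Nat.even_or_odd d with he | ho
  · obtain ⟨w', hw'⟩ := hwalk (i + d) (n - d)
    have hend : f (i + d + (n - d : ℕ)) = f (i + d) := by
      rw [Nat.cast_sub hdn.le, show i + d + ((n : ℤ) - d) = i + n by ring, hper, heq]
    exact hmin (n - d) (by omega) ⟨Nat.Odd.sub_even hdn.le hodd he, _,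
      w'.copy rfl hend, by simp [hw']⟩
  · obtain ⟨w', hw'⟩ := hwalk i d
    exact hmin d hdn ⟨ho, _, w'.copy rfl heq.symm, by simp [hw']⟩

/-- An odd cycle of length 3 is a triangle, one of length 5 is excluded by its colors, and a longer
one unrolls to a line with seven consecutive distinct vertices throughout. -/
lemma core_colorable_two (hG : G.CliqueFree 3) (hc : G.WalkSeparated c) :
    (G.core c).Colorable 2 := by
  by_contra hcol
  obtain ⟨n, f, hodd, hadj, hper, hne⟩ := exists_periodic_of_not_colorable_two hcol
  have line : ∀ m < n, G.IsCoreLine c m f := fun m hm =>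
    ⟨fun i j hij => hij ▸ (hadj i).1, fun i => (hadj i).2.1, fun i j hij hj => by
      obtain ⟨d, rfl⟩ : ∃ d : ℕ, j = i + d := ⟨(j - i).toNat, by omega⟩
      exact hne i d (by omega) (by omega)⟩
  have h1 : n ≠ 1 := by
    rintro rfl
    have := (hadj 0).1
    rw [show (0 : ℤ) + 1 = 0 + (1 : ℕ) by norm_num, hper] at this
    exact this.ne rfl
  have h3 : n ≠ 3 := by
    rintro rfl
    have e : f 3 = f 0 := by simpa using hper 0
    have a := (hadj 2).1
    norm_num [e] at a
    exact not_adj_of_cliqueFree hG (by simpa using (hadj 0).1) (by simpa using (hadj 1).1) a.symm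
  have h5 : n ≠ 5 := by
    rintro rfl
    exact not_isCoreLine_four_of_periodic hG hc (by simpa using hper) (line 4 (by norm_num))
  have h7 : 6 < n := by
    obtain ⟨k, rfl⟩ := hodd
    omega
  exact not_isCoreLine_six hG hc (line 6 h7)

/-! ### Proper colorings from a packing coloring -/

/-- The 3-coloring: the core keeps its 2-coloring, the unanchored vertices of color 2 get the third
color, and so do the vertices of color 1 without unanchored neighbor. Any other vertex of color 1
has at most one neighbor that does not have the third color. -/
lemma exists_three_coloring (hG : G.CliqueFree 3) (hc : G.WalkSeparated c) (hpos : ∀ v, 1 ≤ c v) :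
    ∃ g : V → ℕ, (∀ v, g v < 3) ∧
      ∀ u v, G.Adj u v → c u ≤ 6 → c v ≤ 6 → g u ≠ g v := by
  classical
  obtain ⟨φ⟩ := core_colorable_two hG hc
  let free : V → Prop := fun z => c z = 2 ∧ ¬ G.IsAnchored c z
  let moved : V → Prop := fun y => c y = 1 ∧ ∃ z, G.Adj z y ∧ free z
  -- A moved vertex has at most one neighbor with color in `{3, …, 6}`, so one of the two colors
  -- of `φ` is left for it.
  have hmoved : ∀ y, ∃ b : ℕ, b < 2 ∧ (moved y → ∀ p, G.Adj y p → 3 ≤ c p → c p ≤ 6 →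
      (φ p : ℕ) ≠ b) := by
    intro y
    by_cases hy : moved y ∧ ∃ p, G.Adj y p ∧ 3 ≤ c p ∧ c p ≤ 6
    · obtain ⟨⟨h1, z, hzy, hz⟩, p, hp, hp3, hp6⟩ := hy
      refine ⟨1 - (φ p : ℕ), by omega, fun _ q hq hq3 hq6 => ?_⟩
      have : p = q := by
        by_contra hpq
        exact hz.2 ⟨y, p, q, hzy, hp, hq, h1, hpq, hp3, hp6, hq3, hq6⟩
      subst this
      omega
    · exact ⟨0, by omega, fun hm p hp hp3 hp6 => absurd ⟨hm, p, hp, hp3, hp6⟩ hy⟩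
  choose b hb2 hb using hmoved
  let g : V → ℕ := fun v =>
    if free v then 2 else if c v = 1 then (if moved v then b v else 2) else φ v
  have hprop : ∀ u v, G.Adj u v → c u ≠ c v := fun u v huv e =>
    huv.ne (hc (.cons huv .nil) e (by simpa using hpos u))
  have main : ∀ u v, G.Adj u v → c u < c v → c v ≤ 6 → g u ≠ g v := by
    intro u v huv hlt hv6
    have hu := hpos u
    by_cases h1 : c u = 1
    · have hfu : ¬ free u := fun h => by have := h.1; omega
      have hv1 : c v ≠ 1 := by omega
      by_cases hm : moved u
      · by_cases hfv : free v
        · simp only [g, hfu, hfv, h1, hm, if_true, if_false]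
          exact (hb2 u).ne
        · simp only [g, hfu, hfv, h1, hm, hv1, if_true, if_false]
          have hv3 : 3 ≤ c v := by
            by_contra hv3
            obtain ⟨-, z, hzu, hz⟩ := hm
            have hzv : z = v := hc (.cons hzu (.cons huv .nil)) (by have := hz.1; omega)
              (by simp [hz.1])
            exact hfv (hzv ▸ hz)
          exact (hb u hm v huv hv3 hv6).symm
      · have hfv : ¬ free v := fun h => hm ⟨h1, v, huv.symm, h⟩
        simp only [g, hfu, hfv, h1, hm, hv1, if_true, if_false]
        omega
    · have hv1 : c v ≠ 1 := by omega
      have hfv : ¬ free v := fun h => by have := h.1; omega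
      by_cases hfu : free u
      · simp only [g, hfu, hfv, hv1, if_true, if_false]
        omega
      · simp only [g, hfu, hfv, h1, hv1, if_false]
        have := φ.valid (v := u) (w := v) ⟨huv, ⟨by omega, by omega, fun h => by
          by_contra hn; exact hfu ⟨h, hn⟩⟩, ⟨by omega, hv6, fun h => by omega⟩⟩
        exact fun e => this (Fin.ext e)
  refine ⟨g, fun v => ?_, fun u v huv hu hv => ?_⟩
  · have := hb2 v
    simp only [g]
    split_ifs <;> omega
  · rcases lt_or_gt_of_ne (hprop u v huv) with h | h
    · exact main u v huv h hv
    · exact (main v u huv.symm h hu).symm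

/-- Each color above 6 costs one further color, so a packing coloring saves three colors. -/
lemma IsPackingColoring.colorable (hG : G.CliqueFree 3) {k : ℕ} (hk : 4 ≤ k)
    (h : G.IsPackingColoring (k + 2) c) : G.Colorable (k - 1) := by
  have hpos : ∀ v, 1 ≤ c v := fun v => (h.1 v).1
  obtain ⟨g, hg3, hg⟩ := exists_three_coloring hG h.walkSeparated hpos
  let φ : V → ℕ := fun v => if c v ≤ 6 then g v else c v - 4
  have hφ : ∀ v, φ v < k - 1 := fun v => by
    have := (h.1 v).2
    have := hg3 v
    simp only [φ]
    split_ifs <;> omega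
  refine ⟨Coloring.mk (fun v => ⟨φ v, hφ v⟩) fun {u v} huv e => ?_⟩
  have e' : φ u = φ v := congrArg Fin.val e
  have hne : c u ≠ c v := fun e =>
    huv.ne (h.walkSeparated (.cons huv .nil) e (by simpa using hpos u))
  have hgu := hg3 u
  have hgv := hg3 v
  have := hg u v huv
  simp only [φ] at e'
  split_ifs at e' <;> omega

lemma cliqueFree_of_cliqueNum_lt {n : ℕ} (h0 : G.cliqueNum ≠ 0) (h : G.cliqueNum < n) :
    G.CliqueFree n := by
  intro s hs
  -- A nonzero supremum of natural numbers is one of a bounded set.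
  have hbdd : BddAbove {n | ∃ s, G.IsNClique n s} := by
    by_contra hb
    exact h0 (by rw [cliqueNum, csSup_of_not_bddAbove hb]; simp)
  exact absurd (le_csSup hbdd ⟨s, hs⟩) (not_le.mpr h)

/-! ### Attaining the packing chromatic number -/

lemma exists_isPackingColoring_of_packingChromaticNumber_eq {k : ℕ}
    (h : G.packingChromaticNumber = k) : ∃ c : V → ℕ, G.IsPackingColoring k c := by
  have hne : {k : ℕ | ∃ c : V → ℕ, G.IsPackingColoring k c}.Nonempty := by
    by_contra hemp
    rw [Set.not_nonempty_iff_eq_empty] at hemp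
    rw [packingChromaticNumber, hemp] at h
    simp at h
  have hmem := Nat.sInf_mem hne
  have : ((sInf {k : ℕ | ∃ c : V → ℕ, G.IsPackingColoring k c} : ℕ) : ℕ∞) = k := by
    rw [ENat.natCast_sInf hne, ← h, packingChromaticNumber]
  rw [Nat.cast_inj] at this
  rwa [this] at hmem

end SimpleGraph

theorem mainTheorem2 {V : Type*} (G : SimpleGraph V) (k : ℕ) (hk : 4 ≤ k) :
    ¬ G.Realizes 2 k (k + 2) := by
  rintro ⟨hω, hχ, hρ⟩
  have hG : G.CliqueFree 3 := G.cliqueFree_of_cliqueNum_lt (by omega) (by omega)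
  obtain ⟨c, hc⟩ := G.exists_isPackingColoring_of_packingChromaticNumber_eq (k := k + 2)
    (by exact_mod_cast hρ)
  have hle := (hc.colorable hG hk).chromaticNumber_le
  rw [hχ, Nat.cast_le] at hle
  omega
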